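/- Let $Y$ be a separable real Banach space and let $Y^*$ be its dual with the dual norm. For real Banach spaces $X, Z$ let $\mathrm{Lip}_0(X,Z)$ be the space of Lipschitz maps $f : X \to Z$ with $f(0)=0$, with the norm $$\|f\| = \sup_{p \neq q} \frac{\|f(p)-f(q)\|}{\|p-q\|}.$$ Let $\mathrm{SA}(X,Z)$ be the set of all $f \in \mathrm{Lip}_0(X,Z)$ for which there are points $p \neq q$ of $X$ with $\|f\| = \|f(p)-f(q)\|/\|p-q\|$. Let $\mathrm{Der}(X,Z)$ be the set of all $f \in \mathrm{Lip}_0(X,Z)$ for which there are $x, e \in X$ with $\|e\|=1$ such that the limit $f'(x,e) = \lim_{t \to 0} \frac{f(x+te)-f(x)}{t}$ exists in $Z$ and $\|f'(x,e)\| = \|f\|$. A Banach space $Z$ has the Radon–Nikodým property (RNP) if for every finite measure space $(\Omega,\Sigma,\mu)$ and every $\mu$-continuous vector measure $G : \Sigma \to Z$ of bounded variation there is $g \in L_1(\mu,Z)$ with $G(E) = \int_E g \, d\mu$ for all $E \in \Sigma$. Then the following are equivalent: (a) $Y^*$ has the RNP. (b) $\mathrm{SA}(\mathbb{R},Y^*)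 \cup \mathrm{Der}(\mathbb{R},Y^*)$ is dense in $\mathrm{Lip}_0(\mathbb{R},Y^*)$ with respect to the norm above. -/

import Mathlib

open MeasureTheory
open scoped NNReal ENNReal Topology

universe u v w

/-- A real Banach space `E` has the Radon-Nikodým property if, for every finite measure space
`(Ω, Σ, μ)`, every `μ`-continuous countably additive vector measure `G : Σ → E` of bounded
variation is of the form `G(s) = ∫ₛ g dμ` for some `g ∈ L₁(μ, E)`. -/
def HasRadonNikodymProperty (E : Type u) [NormedAddCommGroup E] [NormedSpace ℝ E] : Prop :=
  ∀ (Ω : Type w) [MeasurableSpace Ω] (μ : Measure Ω) [IsFiniteMeasure μ]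
    (G : VectorMeasure Ω E),
    (∀ s : Set Ω, MeasurableSet s → μ s = 0 → G s = 0) →
    G.variation Set.univ < ∞ →
    ∃ g : Ω → E, Integrable g μ ∧ ∀ s : Set Ω, MeasurableSet s → G s = ∫ ω in s, g ω ∂μ

section LipschitzSpace

variable (X : Type u) (Y : Type v) [NormedAddCommGroup X]
  [NormedAddCommGroup Y] [NormedSpace ℝ Y]

/-- The vector space of Lipschitz maps `X → Y` that vanish at `0`. -/
def lip0Submodule : Submodule ℝ (X → Y) where
  carrier := {f | (∃ K : ℝ≥0, LipschitzWith K f) ∧ f 0 = 0}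
  zero_mem' := ⟨⟨0, LipschitzWith.const 0⟩, rfl⟩
  add_mem' := by
    rintro f g ⟨⟨K, hf⟩, hf0⟩ ⟨⟨L, hg⟩, hg0⟩
    exact ⟨⟨K + L, hf.add hg⟩, by simp [hf0, hg0]⟩
  smul_mem' := by
    rintro c f ⟨⟨K, hf⟩, hf0⟩
    refine ⟨⟨‖c‖₊ * K, ?_⟩, by simp [hf0]⟩
    exact (lipschitzWith_smul c).comp hf

/-- The space `Lip₀(X, Y)`. It is a separate type, so that it carries the topology of
the Lipschitz norm and not the topology of pointwise convergence. -/
def Lip0 : Type (max u v) := ↥(lip0Submodule X Y)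

end LipschitzSpace

namespace Lip0

variable {X : Type u} {Y : Type v} [NormedAddCommGroup X]
  [NormedAddCommGroup Y] [NormedSpace ℝ Y]

instance : AddCommGroup (Lip0 X Y) := inferInstanceAs (AddCommGroup ↥(lip0Submodule X Y))

instance : Module ℝ (Lip0 X Y) := inferInstanceAs (Module ℝ ↥(lip0Submodule X Y))

instance : CoeFun (Lip0 X Y) (fun _ => X → Y) := ⟨fun f => f.1⟩

theorem map_zero (f : Lip0 X Y) : f 0 = 0 := f.2.2

/-- The Lipschitz number: the supremum of `‖f p - f q‖ / ‖p - q‖` over all pairs `p ≠ q`. -/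
noncomputable instance : Norm (Lip0 X Y) :=
  ⟨fun f => ⨆ z : {z : X × X // z.1 ≠ z.2}, ‖f z.1.1 - f z.1.2‖ / ‖z.1.1 - z.1.2‖⟩

theorem norm_def (f : Lip0 X Y) :
    ‖f‖ = ⨆ z : {z : X × X // z.1 ≠ z.2}, ‖f z.1.1 - f z.1.2‖ / ‖z.1.1 - z.1.2‖ := rfl

theorem bddAbove_slopes (f : Lip0 X Y) :
    BddAbove (Set.range fun z : {z : X × X // z.1 ≠ z.2} =>
      ‖f z.1.1 - f z.1.2‖ / ‖z.1.1 - z.1.2‖) := by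
  obtain ⟨K, hK⟩ := f.2.1
  refine ⟨K, ?_⟩
  rintro _ ⟨⟨⟨p, q⟩, hpq⟩, rfl⟩
  have h : 0 < ‖p - q‖ := norm_pos_iff.2 (sub_ne_zero.2 hpq)
  exact (div_le_iff₀ h).2 (hK.norm_sub_le p q)

theorem norm_sub_le (f : Lip0 X Y) (p q : X) : ‖f p - f q‖ ≤ ‖f‖ * ‖p - q‖ := by
  by_cases hpq : p = q
  · simp [hpq]
  · have h : 0 < ‖p - q‖ := norm_pos_iff.2 (sub_ne_zero.2 hpq)
    exact (div_le_iff₀ h).1 (le_ciSup f.bddAbove_slopes ⟨(p, q), hpq⟩)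

theorem norm_nonneg' (f : Lip0 X Y) : 0 ≤ ‖f‖ :=
  Real.iSup_nonneg fun _ => by positivity

theorem norm_le_of_forall (f : Lip0 X Y) {C : ℝ} (hC : 0 ≤ C)
    (h : ∀ p q : X, ‖f p - f q‖ ≤ C * ‖p - q‖) : ‖f‖ ≤ C :=
  Real.iSup_le (fun _ => div_le_of_le_mul₀ (norm_nonneg _) hC (h _ _)) hC

theorem norm_smul_le' (c : ℝ) (f : Lip0 X Y) : ‖c • f‖ ≤ ‖c‖ * ‖f‖ := by
  refine norm_le_of_forall _ (mul_nonneg (norm_nonneg _) f.norm_nonneg') fun p q => ?_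
  change ‖c • f p - c • f q‖ ≤ _
  rw [← smul_sub, norm_smul, mul_assoc]
  exact mul_le_mul_of_nonneg_left (f.norm_sub_le p q) (norm_nonneg _)

theorem normCore : NormedSpace.Core ℝ (Lip0 X Y) where
  norm_nonneg := norm_nonneg'
  norm_smul c f := by
    refine le_antisymm (norm_smul_le' c f) ?_
    by_cases hc : c = 0
    · subst hc
      simpa using norm_nonneg' ((0 : ℝ) • f)
    · have h := norm_smul_le' c⁻¹ (c • f)
      rw [inv_smul_smul₀ hc, norm_inv] at h
      have hc' : 0 < ‖c‖ := norm_pos_iff.2 hc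
      calc ‖c‖ * ‖f‖ ≤ ‖c‖ * (‖c‖⁻¹ * ‖c • f‖) := mul_le_mul_of_nonneg_left h hc'.le
        _ = ‖c • f‖ := by field_simp
  norm_triangle f g := by
    refine norm_le_of_forall _ (add_nonneg f.norm_nonneg' g.norm_nonneg') fun p q => ?_
    change ‖(f p + g p) - (f q + g q)‖ ≤ _
    rw [add_sub_add_comm, add_mul]
    exact (norm_add_le _ _).trans (add_le_add (f.norm_sub_le p q) (g.norm_sub_le p q))
  norm_eq_zero_iff f := by
    constructor
    · intro h
      refine Subtype.ext (funext fun x => ?_)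
      have h1 := f.norm_sub_le x 0
      rw [h, zero_mul, f.map_zero, sub_zero] at h1
      exact norm_le_zero_iff.1 h1
    · rintro rfl
      refine le_antisymm (norm_le_of_forall _ le_rfl fun p q => ?_) (norm_nonneg' _)
      change ‖(0 : Y) - 0‖ ≤ _
      simp

noncomputable instance : NormedAddCommGroup (Lip0 X Y) := NormedAddCommGroup.ofCore normCore

noncomputable instance : NormedSpace ℝ (Lip0 X Y) := NormedSpace.ofCore normCore

end Lip0

section Attainment

variable (X : Type u) (Y : Type v) [NormedAddCommGroup X] [NormedSpace ℝ X]
  [NormedAddCommGroup Y] [NormedSpace ℝ Y]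

/-- `SA(X, Y)`: the maps in `Lip₀(X, Y)` that strongly attain their norm. -/
def SA : Set (Lip0 X Y) :=
  {f | ∃ p q : X, p ≠ q ∧ ‖f‖ = ‖f p - f q‖ / ‖p - q‖}

/-- `Der(X, Y)`: the maps in `Lip₀(X, Y)` that attain their maximal derivative, that is, for some
point `x` and some unit vector `e` the (two-sided) directional derivative
`lim_{t → 0} (f (x + t e) - f x) / t` exists in `Y` and has norm `‖f‖`. -/
def Der : Set (Lip0 X Y) :=
  {f | ∃ x e : X, ‖e‖ = 1 ∧ ∃ y : Y,
    Filter.Tendsto (fun t : ℝ => t⁻¹ • (f (x + t • e) - f x)) (𝓝[≠] 0) (𝓝 y) ∧ ‖y‖ = ‖f‖}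

end Attainment

/-! ### Weak-star measurability and weak-star densities. -/

section WeakStar

variable {Y : Type u} [NormedAddCommGroup Y] [NormedSpace ℝ Y]
  {Ω : Type w} [MeasurableSpace Ω]

/-! Everything is a question about derivatives. A Lipschitz curve in `Y*` always has a derivative
tested against each fixed `y`, almost everywhere; the RNP upgrades this to norm derivatives, that
is, it makes weak-star densities strongly measurable.

RNP implies density (`dense_SA_union_Der_of_hasRadonNikodymProperty`): by
`LipschitzWith.exists_density`, `f` is the integral of a Bochner density `g` on an interval of
nearly maximal slope. On a set of positive measure `g` has nearly maximal norm and stays close to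
one vector `v`. Replacing `g` there by a slightly longer multiple `w` of `v` perturbs `f` little and
gives a curve whose norm is the derivative `w`.

Density implies RNP (`aestronglyMeasurable_of_dense_of_norm_eq`): let `φ` be weak-star measurable on
the line, of norm 0 or 1, with primitive `F`, but not strongly measurable. Then `φ` stays away from
all rational slopes of `F` on a compact set `A` of positive measure without rational points. Let `f`
be the primitive of `φ` restricted to `A`. A map near `f` cannot attain its norm on a pair, since
`f` is constant near each rational. Nor can it attain it by a derivative: at such a point `x` the
set `A` has nearly full density, so `F` nearly has the same derivative and `φ x` is close to a
rational slope. General `φ` follow by normalization, and general finite measure spaces by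
transporting laws to the unit interval. Strong measurability of all bounded weak-star measurable
maps yields the RNP, because a vector measure always has a weak-star density with respect to its
variation (`exists_weakStar_density`). -/

theorem exists_seq_norm_le_iff (Y : Type u) [NormedAddCommGroup Y] [NormedSpace ℝ Y]
    [TopologicalSpace.SeparableSpace Y] :
    ∃ b : ℕ → Y, (∀ n, ‖b n‖ ≤ 1) ∧ (∀ y, ‖y‖ ≤ 1 → y ∈ closure (Set.range b)) ∧
      ∀ (φ : StrongDual ℝ Y) (r : ℝ), ‖φ‖ ≤ r ↔ 0 ≤ r ∧ ∀ n, |φ (b n)| ≤ r := by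
  have : Nonempty (Metric.closedBall (0 : Y) 1) := ⟨⟨0, by simp⟩⟩
  have : TopologicalSpace.SeparableSpace (Metric.closedBall (0 : Y) 1) := by
    have := UniformSpace.secondCountable_of_separable Y
    infer_instance
  let b := TopologicalSpace.denseSeq (Metric.closedBall (0 : Y) 1)
  have hb := TopologicalSpace.denseRange_denseSeq (Metric.closedBall (0 : Y) 1)
  have hb1 : ∀ n, ‖(b n : Y)‖ ≤ 1 := fun n => mem_closedBall_zero_iff.1 (b n).2
  have hbc : ∀ y : Y, ‖y‖ ≤ 1 → y ∈ closure (Set.range fun n => (b n : Y)) := fun y hy => by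
    have := image_closure_subset_closure_image continuous_subtype_val
      (Set.mem_image_of_mem Subtype.val (hb ⟨y, mem_closedBall_zero_iff.2 hy⟩))
    rwa [← Set.range_comp] at this
  refine ⟨fun n => b n, hb1, hbc, fun φ r => ⟨fun h => ⟨(norm_nonneg _).trans h, fun n => ?_⟩, ?_⟩⟩
  · calc |φ (b n)| ≤ ‖φ‖ * ‖(b n : Y)‖ := φ.le_opNorm _
      _ ≤ ‖φ‖ * 1 := by gcongr; exact hb1 n
      _ ≤ r := by simpa using h
  · rintro ⟨hr, h⟩
    have key : ∀ y : Metric.closedBall (0 : Y) 1, |φ y| ≤ r := fun y =>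
      hb.induction_on (p := fun y : Metric.closedBall (0 : Y) 1 => |φ y| ≤ r) y
        (isClosed_le (by fun_prop) continuous_const) h
    refine φ.opNorm_le_bound hr fun y => ?_
    rcases eq_or_ne y 0 with rfl | hy
    · simp
    have hy' : 0 < ‖y‖ := norm_pos_iff.2 hy
    have := key ⟨‖y‖⁻¹ • y, by simp [norm_smul, hy'.ne']⟩
    simp only [map_smul, smul_eq_mul, abs_mul, abs_inv, abs_norm] at this
    rw [inv_mul_le_iff₀ hy'] at this
    rw [Real.norm_eq_abs]; linarith

variable [TopologicalSpace.SeparableSpace Y]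

theorem measurable_norm_of_weakStar {φ : Ω → StrongDual ℝ Y}
    (hφ : ∀ y, Measurable fun ω => φ ω y) : Measurable fun ω => ‖φ ω‖ := by
  obtain ⟨b, -, -, hb⟩ := exists_seq_norm_le_iff Y
  refine measurable_of_Iic fun r => ?_
  have : (fun ω => ‖φ ω‖) ⁻¹' Set.Iic r = {_ω | 0 ≤ r} ∩ ⋂ n, {ω | |φ ω (b n)| ≤ r} := by
    ext ω; simp [hb]
  rw [this]
  exact (MeasurableSet.const _).inter
    (.iInter fun n => measurableSet_le (hφ _).norm measurable_const)

/-- A form of Pettis' theorem. Distances to fixed functionals are measurable because `Y` is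
separable, so choosing the first `c n` within `1/(k+1)` gives countably valued measurable
approximants. -/
theorem aestronglyMeasurable_of_weakStar {μ : Measure Ω} {φ : Ω → StrongDual ℝ Y}
    (hφ : ∀ y, Measurable fun ω => φ ω y)
    (h : ∀ ε > 0, ∃ c : ℕ → StrongDual ℝ Y, ∀ᵐ ω ∂μ, ∃ n, ‖φ ω - c n‖ < ε) :
    AEStronglyMeasurable φ μ := by
  classical
  choose! c hc using h
  let e : ℕ → ℝ := fun k => ((k : ℝ) + 1)⁻¹
  have he : ∀ k, 0 < e k := fun k => by positivity
  -- The second alternative makes the search total: on the exceptional null set it returns index 0.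
  let P : ℕ → Ω → ℕ → Prop := fun k ω n => ‖φ ω - c (e k) n‖ < e k ∨ ∀ m, ¬ ‖φ ω - c (e k) m‖ < e k
  have hP : ∀ k ω, ∃ n, P k ω n := fun k ω => by
    by_cases H : ∃ n, ‖φ ω - c (e k) n‖ < e k
    · exact H.imp fun _ => Or.inl
    · exact ⟨0, Or.inr (not_exists.1 H)⟩
  have hM : ∀ k n, MeasurableSet {ω | ‖φ ω - c (e k) n‖ < e k} := fun k n =>
    measurableSet_lt (measurable_norm_of_weakStar fun y => (hφ y).sub_const _) measurable_const
  have hN : ∀ k, Measurable fun ω => Nat.find (hP k ω) := fun k => by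
    refine measurable_find (hP k) fun n => ?_
    exact (hM k n).union (by
      have : {ω | ∀ m, ¬ ‖φ ω - c (e k) m‖ < e k} = ⋂ m, {ω | ‖φ ω - c (e k) m‖ < e k}ᶜ := by
        ext; simp
      change MeasurableSet {ω | ∀ m, ¬ ‖φ ω - c (e k) m‖ < e k}
      rw [this]
      exact MeasurableSet.iInter fun m => (hM k m).compl)
  refine aestronglyMeasurable_of_tendsto_ae (u := Filter.atTop)
    (f := fun k ω => c (e k) (Nat.find (hP k ω))) (fun k => ?_) ?_
  · exact ((StronglyMeasurable.of_discrete (f := c (e k))).comp_measurable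
      (hN k)).aestronglyMeasurable
  · filter_upwards [ae_all_iff.2 fun k => hc (e k) (he k)] with ω hω
    rw [tendsto_iff_norm_sub_tendsto_zero]
    refine squeeze_zero (fun _ => norm_nonneg _) (fun k => ?_)
      tendsto_one_div_add_atTop_nhds_zero_nat
    rcases Nat.find_spec (hP k ω) with h | h
    · rw [norm_sub_rev]; simpa [e] using h.le
    · obtain ⟨n, hn⟩ := hω k
      exact absurd hn (h n)

/-- Every vector measure with values in the dual of a separable space that is dominated by a
finite measure has a weak-star density. -/
theorem exists_weakStar_density {ν : Measure Ω} [IsFiniteMeasure ν]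
    (G : VectorMeasure Ω (StrongDual ℝ Y)) (hG : ∀ s, MeasurableSet s → ‖G s‖ₑ ≤ ν s) :
    ∃ h : Ω → StrongDual ℝ Y, (∀ y, Measurable fun ω => h ω y) ∧ (∀ ω, ‖h ω‖ ≤ 1) ∧
      ∀ s, MeasurableSet s → ∀ y, G s y = ∫ ω in s, h ω y ∂ν := by
  classical
  let S : Y → SignedMeasure Ω := fun y =>
    G.mapRange ((ContinuousLinearMap.apply ℝ ℝ y : StrongDual ℝ Y →L[ℝ] ℝ) :
      StrongDual ℝ Y →+ ℝ) (ContinuousLinearMap.apply ℝ ℝ y).continuous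
  let u : Y → Ω → ℝ := fun y => (S y).rnDeriv ν
  have hS : ∀ y s, S y s = G s y := fun y s => rfl
  have hnorm : ∀ s, MeasurableSet s → ∀ y, |G s y| ≤ ν.real s * ‖y‖ := fun s hs y => by
    have h1 : ‖G s‖ ≤ ν.real s := by
      have := ENNReal.toReal_mono (measure_ne_top ν s) (hG s hs)
      simpa [Measure.real] using this
    exact ((G s).le_opNorm y).trans (by gcongr)
  have hac : ∀ y, S y ≪ᵥ ν.toENNRealVectorMeasure := fun y =>
    VectorMeasure.AbsolutelyContinuous.mk fun s hs h0 => by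
      rw [Measure.toENNRealVectorMeasure_apply_measurable hs] at h0
      have := hnorm s hs y
      rw [Measure.real, h0] at this
      simpa [hS] using this
  have hint : ∀ y, Integrable (u y) ν := fun y => SignedMeasure.integrable_rnDeriv _ _
  have hmeas : ∀ y, Measurable (u y) := fun y => SignedMeasure.measurable_rnDeriv _ _
  have hu : ∀ y s, MeasurableSet s → ∫ ω in s, u y ω ∂ν = G s y := fun y s hs => by
    rw [← hS, ← withDensityᵥ_apply (hint y) hs, SignedMeasure.withDensityᵥ_rnDeriv_eq _ _ (hac y)]
  have hadd : ∀ y z, ∀ᵐ ω ∂ν, u (y + z) ω = u y ω + u z ω := fun y z => by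
    refine (hint _).ae_eq_of_forall_setIntegral_eq _ (fun ω => u y ω + u z ω)
      ((hint y).add (hint z)) fun s hs _ => ?_
    rw [integral_add (hint y).integrableOn (hint z).integrableOn, hu _ _ hs, hu _ _ hs, hu _ _ hs,
      map_add]
  have hle : ∀ y, ∀ᵐ ω ∂ν, u y ω ≤ ‖y‖ := fun y => by
    refine ae_le_of_forall_setIntegral_le (hint y) (integrable_const _) fun s hs _ => ?_
    rw [hu _ _ hs]
    simpa using (le_abs_self _).trans (hnorm s hs y)
  -- A countable dense subgroup suffices: real homogeneity comes for free, since a continuous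
  -- additive map is real linear. Countability puts all the almost-everywhere relations on `D`
  -- outside one null set.
  let D : AddSubgroup Y := (Submodule.span ℤ (Set.range (TopologicalSpace.denseSeq Y))).toAddSubgroup
  have hDc : Countable D :=
    inferInstanceAs (Countable (Submodule.span ℤ (Set.range (TopologicalSpace.denseSeq Y))))
  have hDd : Dense (D : Set Y) :=
    (TopologicalSpace.denseRange_denseSeq Y).mono Submodule.subset_span
  have hgood : ∀ᵐ ω ∂ν, ∀ y z : D, u (y + z) ω = u y ω + u z ω ∧ u y ω ≤ ‖(y : Y)‖ :=
    ae_all_iff.2 fun y => ae_all_iff.2 fun z => (hadd y z).and (hle y)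
  have hext : ∀ ω, ∃ φ : StrongDual ℝ Y, ‖φ‖ ≤ 1 ∧
      ((∀ y z : D, u (y + z) ω = u y ω + u z ω ∧ u y ω ≤ ‖(y : Y)‖) →
        ∀ y : D, φ y = u y ω) := fun ω => by
    by_cases H : ∀ y z : D, u (y + z) ω = u y ω + u z ω ∧ u y ω ≤ ‖(y : Y)‖
    swap
    · exact ⟨0, by simp, fun h => absurd h H⟩
    have hsub : ∀ y z : D, u y ω - u z ω ≤ ‖(y : Y) - z‖ := fun y z => by
      have h1 := (H (y - z) z).1
      have h2 := (H (y - z) z).2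
      simp only [AddSubgroup.coe_sub, sub_add_cancel] at h1 h2
      linarith
    have hlip : LipschitzOnWith 1 (fun y => u y ω) (D : Set Y) :=
      LipschitzOnWith.of_le_add_mul 1 fun y hy z hz => by
        have := hsub ⟨y, hy⟩ ⟨z, hz⟩
        rw [dist_eq_norm]; simp only [NNReal.coe_one, one_mul]; linarith
    obtain ⟨g, hg, hgD⟩ := hlip.extend_real
    have hgadd : ∀ y z, g (y + z) = g y + g z := by
      have hcl : IsClosed {p : Y × Y | g (p.1 + p.2) = g p.1 + g p.2} :=
        isClosed_eq (hg.continuous.comp (by fun_prop))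
          ((hg.continuous.comp continuous_fst).add (hg.continuous.comp continuous_snd))
      intro y z
      have : (y, z) ∈ closure ((D : Set Y) ×ˢ (D : Set Y)) := (hDd.prod hDd) (y, z)
      refine hcl.closure_subset_iff.2 ?_ this
      rintro ⟨a, b⟩ ⟨ha, hb⟩
      change g (a + b) = g a + g b
      rw [← hgD ha, ← hgD hb, ← hgD (D.add_mem ha hb)]
      exact (H ⟨a, ha⟩ ⟨b, hb⟩).1
    let φ : StrongDual ℝ Y := (AddMonoidHom.mk' g hgadd).toRealLinearMap hg.continuous
    refine ⟨φ, ?_, fun _ y => (hgD y.2).symm⟩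
    refine φ.opNorm_le_bound zero_le_one fun y => ?_
    have h0 : g 0 = 0 := by have := hgadd 0 0; simp at this; exact this
    have := hg.dist_le_mul y 0
    rw [h0, dist_zero_right, dist_zero_right] at this
    exact this
  choose φ hφ1 hφD using hext
  obtain ⟨t, htsub, htm, ht0⟩ := exists_measurable_superset_of_null (ae_iff.1 hgood)
  have hφt : ∀ ω ∉ t, ∀ y : D, φ ω y = u y ω := fun ω hω =>
    hφD ω (by by_contra H; exact hω (htsub H))
  have ht : ∀ᵐ ω ∂ν, ω ∉ t := measure_eq_zero_iff_ae_notMem.1 ht0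
  -- Cutting off on a measurable null set gives measurability everywhere, not only almost
  -- everywhere.
  let h : Ω → StrongDual ℝ Y := tᶜ.indicator φ
  have hh1 : ∀ ω, ‖h ω‖ ≤ 1 := fun ω => by
    by_cases hω : ω ∈ tᶜ
    · simpa [h, hω] using hφ1 ω
    · simp [h, Set.indicator_of_notMem hω]
  have hhD : ∀ y : D, Measurable fun ω => h ω y := fun y => by
    have : (fun ω => h ω y) = tᶜ.indicator (u y) := by
      ext ω
      by_cases hω : ω ∈ tᶜ
      · simp only [h, Set.indicator_of_mem hω]; exact hφt ω hω y
      · simp [h, Set.indicator_of_notMem hω]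
    rw [this]
    exact (hmeas y).indicator htm.compl
  have hhm : ∀ y, Measurable fun ω => h ω y := fun y => by
    obtain ⟨s, hs, hlim⟩ := mem_closure_iff_seq_limit.1 (hDd y)
    refine measurable_of_tendsto_metrizable (f := fun n ω => h ω (s n))
      (fun n => hhD ⟨s n, hs n⟩) ?_
    exact tendsto_pi_nhds.2 fun ω => ((h ω).continuous.tendsto y).comp hlim
  refine ⟨h, hhm, hh1, fun s hs y => ?_⟩
  have hhi : ∀ y, Integrable (fun ω => h ω y) ν := fun y =>
    Integrable.of_bound (hhm y).aestronglyMeasurable ‖y‖ (.of_forall fun ω =>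
      ((h ω).le_opNorm y).trans (mul_le_of_le_one_left (norm_nonneg _) (hh1 ω)))
  let I : StrongDual ℝ Y := LinearMap.mkContinuous
    { toFun := fun y => ∫ ω in s, h ω y ∂ν
      map_add' := fun y z => by
        simp only [map_add]
        exact integral_add (hhi y).integrableOn (hhi z).integrableOn
      map_smul' := fun c y => by
        simp only [map_smul, smul_eq_mul, RingHom.id_apply]
        exact integral_const_mul c _ } (ν.real s) (fun y => by
      have := norm_setIntegral_le_of_norm_le_const (f := fun ω => h ω y) (C := ‖y‖)
        (measure_lt_top ν s) (fun ω _ => ((h ω).le_opNorm y).trans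
          (mul_le_of_le_one_left (norm_nonneg _) (hh1 ω)))
      rw [mul_comm]; exact this)
  have hGI : (G s : Y → ℝ) = I := by
    refine Continuous.ext_on hDd (G s).continuous I.continuous fun y hy => ?_
    change G s y = ∫ ω in s, h ω y ∂ν
    rw [← hu y s hs]
    refine setIntegral_congr_ae hs ?_
    filter_upwards [ht] with ω hω _
    simp only [h, Set.indicator_of_mem (show ω ∈ tᶜ from hω)]
    exact (hφt ω hω ⟨y, hy⟩).symm
  exact congrFun hGI y

/-- A weak-star density with respect to the variation of `G`, once strongly measurable, is a Bochner
density; multiplying by the scalar derivative of the variation gives one with respect to `μ`. -/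
theorem hasRadonNikodymProperty_of_aestronglyMeasurable
    (H : ∀ (Ω : Type w) [MeasurableSpace Ω] (ν : Measure Ω) [IsFiniteMeasure ν]
      (h : Ω → StrongDual ℝ Y), (∀ y, Measurable fun ω => h ω y) → (∀ ω, ‖h ω‖ ≤ 1) →
      AEStronglyMeasurable h ν) :
    HasRadonNikodymProperty.{u, w} (StrongDual ℝ Y) := by
  intro Ω _ μ _ G hGμ hG
  have : IsFiniteMeasure G.variation := ⟨hG⟩
  obtain ⟨h, hm, h1, hh⟩ := exists_weakStar_density (ν := G.variation) G
    fun s _ => VectorMeasure.enorm_measure_le_variation G s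
  have hsm := H Ω G.variation h hm h1
  have hint : Integrable h G.variation := .of_bound hsm 1 (.of_forall h1)
  have hac : G.variation ≪ μ := Measure.AbsolutelyContinuous.mk fun s hs h0 =>
    (VectorMeasure.variation_apply_eq_zero hs).2 fun t hts ht =>
      hGμ t ht (measure_mono_null hts h0)
  refine ⟨fun ω => (G.variation.rnDeriv μ ω).toReal • h ω,
    (integrable_rnDeriv_smul_iff hac).2 hint, fun s hs => ?_⟩
  rw [setIntegral_rnDeriv_smul hac hs]
  ext y
  rw [hh s hs y, ContinuousLinearMap.integral_apply hint.integrableOn]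

end WeakStar

/-! ### The RNP implies density of the norm-attaining maps. -/

section RadonNikodymToDense

variable {Y : Type u} [NormedAddCommGroup Y] [NormedSpace ℝ Y]

theorem LipschitzWith.strongDual_apply {f : ℝ → StrongDual ℝ Y} {K : ℝ≥0}
    (hf : LipschitzWith K f) (y : Y) : LipschitzWith (K * ‖y‖₊) fun t => f t y :=
  LipschitzWith.of_dist_le_mul fun s t => by
    rw [dist_eq_norm, ← sub_apply]
    calc ‖(f s - f t) y‖ ≤ ‖f s - f t‖ * ‖y‖ := (f s - f t).le_opNorm y
      _ ≤ (K * dist s t) * ‖y‖ := by gcongr; rw [← dist_eq_norm]; exact hf.dist_le_mul s t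
      _ = _ := by push_cast; ring

theorem LipschitzWith.norm_sub_le_of_ae_abs_deriv_le {h : ℝ → ℝ} {K : ℝ≥0} (hh : LipschitzWith K h)
    {C : ℝ} (hC : ∀ᵐ x, |deriv h x| ≤ C) (a b : ℝ) : |h b - h a| ≤ C * |b - a| := by
  rw [← (hh.lipschitzOnWith (s := Set.uIcc a b)).absolutelyContinuousOnInterval.integral_deriv_eq_sub]
  exact intervalIntegral.norm_integral_le_of_norm_le_const_ae
    (hC.mono fun x hx _ => (Real.norm_eq_abs _).trans_le hx)

/-- The converse of a weak-star density: linearity in `y` is needed only almost everywhere for each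
choice of vectors, because integration removes the null sets. -/
theorem exists_vectorMeasure_apply {Ω : Type w} [MeasurableSpace Ω] {μ : Measure Ω}
    [IsFiniteMeasure μ] {K : ℝ≥0} {u : Y → Ω → ℝ} (hm : ∀ y, AEStronglyMeasurable (u y) μ)
    (hK : ∀ y, ∀ᵐ ω ∂μ, |u y ω| ≤ K * ‖y‖)
    (hadd : ∀ y z, ∀ᵐ ω ∂μ, u (y + z) ω = u y ω + u z ω)
    (hsmul : ∀ (c : ℝ) y, ∀ᵐ ω ∂μ, u (c • y) ω = c * u y ω) :
    ∃ G : VectorMeasure Ω (StrongDual ℝ Y), (∀ s, ‖G s‖ₑ ≤ (K • μ) s) ∧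
      ∀ s, MeasurableSet s → ∀ y, G s y = ∫ ω in s, u y ω ∂μ := by
  classical
  have hint : ∀ y, Integrable (u y) μ := fun y => .of_bound (hm y) _ (hK y)
  let I : Set Ω → StrongDual ℝ Y := fun s => LinearMap.mkContinuous
    { toFun := fun y => ∫ ω in s, u y ω ∂μ
      map_add' := fun y z => by
        rw [← integral_add (hint y).integrableOn (hint z).integrableOn]
        exact integral_congr_ae (ae_restrict_of_ae (hadd y z))
      map_smul' := fun c y => by
        rw [smul_eq_mul, ← integral_const_mul]
        exact integral_congr_ae (ae_restrict_of_ae (hsmul c y)) } (K * μ.real s) (fun y => by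
      have := norm_setIntegral_le_of_norm_le_const_ae' (f := u y) (C := K * ‖y‖)
        (measure_lt_top μ s) ((hK y).mono fun ω h _ => h)
      refine this.trans_eq (by ring))
  have hI : ∀ s y, I s y = ∫ ω in s, u y ω ∂μ := fun s y => rfl
  have hIn : ∀ s, ‖I s‖ ≤ K * μ.real s := fun s => LinearMap.mkContinuous_norm_le _ (by positivity) _
  refine ⟨VectorMeasure.of_additive_of_le_measure (μ := K • μ)
    (fun s => if MeasurableSet s then I s else 0) (fun s => ?_) (fun s t hs ht hst => ?_)
    (fun s hs => if_neg hs), fun s => ?_, fun s hs y => ?_⟩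
  rotate_left
  · simp only [hs, ht, hs.union ht, if_true]
    ext y
    simp only [add_apply, hI]
    exact setIntegral_union hst ht (hint y).integrableOn (hint y).integrableOn
  rotate_left
  · change (if MeasurableSet s then I s else 0) y = _
    rw [if_pos hs, hI]
  all_goals
    change ‖if MeasurableSet s then I s else 0‖ₑ ≤ _
    split_ifs
    · rw [← ofReal_norm]
      refine (ENNReal.ofReal_le_ofReal (hIn s)).trans_eq ?_
      rw [ENNReal.ofReal_mul (by positivity), Measure.real, ENNReal.ofReal_toReal (measure_ne_top _ _)]
      rw [ENNReal.ofReal_coe_nnreal, Measure.smul_apply, ENNReal.smul_def, smul_eq_mul]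
    · rw [← ofReal_norm, norm_zero, ENNReal.ofReal_zero]; exact zero_le

/-- The scalar derivatives of `f` tested against each `y` integrate to a vector measure dominated by
`K` times Lebesgue measure; its RNP density integrates back to `f`. The interval is lifted to the
universe of the spaces in `hZ`. -/
theorem LipschitzWith.exists_density (hZ : HasRadonNikodymProperty.{u, w} (StrongDual ℝ Y))
    {f : ℝ → StrongDual ℝ Y} {K : ℝ≥0} (hf : LipschitzWith K f) (p q : ℝ) :
    ∃ g : ℝ → StrongDual ℝ Y, StronglyMeasurable g ∧ IntegrableOn g (Set.Ioc p q) ∧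
      ∀ x ∈ Set.Icc p q, f x - f p = ∫ t in p..x, g t := by
  let e : ULift.{w} ℝ ≃ᵐ ℝ := MeasurableEquiv.ulift
  let μ : Measure (ULift.{w} ℝ) := (volume.restrict (Set.Ioc p q)).map e.symm
  have : IsFiniteMeasure μ := by dsimp only [μ]; infer_instance
  have hae : ∀ P : ℝ → Prop, (∀ᵐ t, P t) → ∀ᵐ ω ∂μ, P (e ω) := fun P hP => by
    rw [e.symm.measurableEmbedding.ae_map_iff]
    simp only [MeasurableEquiv.apply_symm_apply]
    exact ae_restrict_of_ae hP
  have hd : ∀ y, ∀ᵐ t, DifferentiableAt ℝ (fun s => f s y) t := fun y =>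
    (hf.strongDual_apply y).ae_differentiableAt_real
  obtain ⟨G, hGle, hG⟩ := exists_vectorMeasure_apply (μ := μ) (K := K)
    (u := fun y ω => deriv (fun s => f s y) (e ω))
    (fun y => ((measurable_deriv _).comp e.measurable).aestronglyMeasurable)
    (fun y => .of_forall fun ω => by
      simpa using norm_deriv_le_of_lipschitz (hf.strongDual_apply y) (x₀ := e ω))
    (fun y z => hae (fun t => deriv (fun s => f s (y + z)) t = _) (by
      filter_upwards [hd y, hd z] with t hy hz
      simp only [map_add]
      exact deriv_fun_add hy hz))
    (fun c y => hae (fun t => deriv (fun s => f s (c • y)) t = _) (by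
      filter_upwards [hd y] with t hy
      simp only [map_smul, smul_eq_mul]
      exact deriv_const_mul c hy))
  obtain ⟨g₀, hg₀, hGg⟩ := hZ _ μ G
    (fun s _ h0 => by
      have := hGle s
      rwa [Measure.smul_apply, h0, smul_zero, nonpos_iff_eq_zero, ← ofReal_norm,
        ENNReal.ofReal_eq_zero, norm_le_zero_iff] at this)
    ((VectorMeasure.variation_le_of_forall_enorm_le (m := K • μ) (fun s _ => hGle s) _).trans_lt
      (measure_lt_top _ _))
  have hg₁ : IntegrableOn (g₀ ∘ e.symm) (Set.Ioc p q) :=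
    e.symm.measurableEmbedding.integrable_map_iff.1 hg₀
  refine ⟨hg₁.1.mk, hg₁.1.stronglyMeasurable_mk, hg₁.congr hg₁.1.ae_eq_mk, fun x hx => ?_⟩
  have hsub : Set.Ioc p x ⊆ Set.Ioc p q := Set.Ioc_subset_Ioc_right hx.2
  have h1 : ∫ t in p..x, hg₁.1.mk _ t = ∫ t in Set.Ioc p x, g₀ (e.symm t) := by
    rw [intervalIntegral.integral_of_le hx.1]
    exact integral_congr_ae (ae_restrict_of_ae_restrict_of_subset hsub hg₁.1.ae_eq_mk.symm)
  have hpre : e.symm ⁻¹' (e ⁻¹' Set.Ioc p x) = Set.Ioc p x := by ext; simp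
  have hres : ∀ {E : Type u} [NormedAddCommGroup E] [NormedSpace ℝ E] (k : ULift.{w} ℝ → E),
      ∫ ω in e ⁻¹' Set.Ioc p x, k ω ∂μ = ∫ t in Set.Ioc p x, k (e.symm t) := fun k => by
    rw [e.symm.measurableEmbedding.setIntegral_map, hpre,
      Measure.restrict_restrict_of_subset hsub]
  have hres' : ∀ (k : ULift.{w} ℝ → ℝ),
      ∫ ω in e ⁻¹' Set.Ioc p x, k ω ∂μ = ∫ t in Set.Ioc p x, k (e.symm t) := fun k => by
    rw [e.symm.measurableEmbedding.setIntegral_map, hpre,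
      Measure.restrict_restrict_of_subset hsub]
  rw [h1, ← hres, ← hGg _ (e.measurable measurableSet_Ioc)]
  ext y
  rw [hG _ (e.measurable measurableSet_Ioc), hres', sub_apply,
    ← ((hf.strongDual_apply y).lipschitzOnWith
      (s := Set.uIcc p x)).absolutelyContinuousOnInterval.integral_deriv_eq_sub,
    intervalIntegral.integral_of_le hx.1]
  simp

end RadonNikodymToDense

theorem mem_Der_real_iff {Z : Type u} [NormedAddCommGroup Z] [NormedSpace ℝ Z] {f : Lip0 ℝ Z} :
    f ∈ Der ℝ Z ↔ ∃ x z, HasDerivAt f z x ∧ ‖z‖ = ‖f‖ := by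
  constructor
  · rintro ⟨x, e, he, y, hy, hn⟩
    have he0 : e ≠ 0 := by rintro rfl; simp at he
    refine ⟨x, e⁻¹ • y, ?_, by rw [norm_smul, norm_inv, he, hn]; simp⟩
    rw [hasDerivAt_iff_tendsto_slope_zero]
    have ht : Filter.Tendsto (fun t : ℝ => t * e⁻¹) (𝓝[≠] 0) (𝓝[≠] 0) := by
      refine tendsto_nhdsWithin_iff.2 ⟨?_, ?_⟩
      · have : Filter.Tendsto (fun t : ℝ => t * e⁻¹) (𝓝 0) (𝓝 (0 * e⁻¹)) :=
          (continuous_id.mul continuous_const).tendsto 0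
        rw [zero_mul] at this
        exact this.mono_left nhdsWithin_le_nhds
      · filter_upwards [self_mem_nhdsWithin] with t ht
        exact mul_ne_zero ht (inv_ne_zero he0)
    refine ((hy.comp ht).const_smul e⁻¹).congr fun t => ?_
    simp only [Function.comp_apply, smul_eq_mul, smul_smul, mul_inv, inv_inv]
    rw [inv_mul_cancel_right₀ he0, mul_comm t⁻¹ e, inv_mul_cancel_left₀ he0]
  · rintro ⟨x, z, hz, hn⟩
    refine ⟨x, 1, by simp, z, ?_, hn⟩
    simpa using hasDerivAt_iff_tendsto_slope_zero.1 hz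

theorem Lip0.lipschitzWith {X : Type u} {Z : Type v} [NormedAddCommGroup X]
    [NormedAddCommGroup Z] [NormedSpace ℝ Z] (f : Lip0 X Z) : LipschitzWith ‖f‖.toNNReal f :=
  LipschitzWith.of_dist_le_mul fun p q => by
    rw [dist_eq_norm, dist_eq_norm, Real.coe_toNNReal _ f.norm_nonneg']
    exact f.norm_sub_le p q

theorem Lip0.norm_le_of_hasDerivAt {Z : Type u} [NormedAddCommGroup Z] [NormedSpace ℝ Z]
    (f : Lip0 ℝ Z) {x : ℝ} {z : Z} (h : HasDerivAt f z x) : ‖z‖ ≤ ‖f‖ := by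
  have := norm_deriv_le_of_lipschitz f.lipschitzWith (x₀ := x)
  rwa [h.deriv, Real.coe_toNNReal _ f.norm_nonneg'] at this

theorem dense_SA_union_Der_of_hasRadonNikodymProperty {Y : Type u} [NormedAddCommGroup Y]
    [NormedSpace ℝ Y] (hZ : HasRadonNikodymProperty.{u, w} (StrongDual ℝ Y)) :
    Dense (SA ℝ (StrongDual ℝ Y) ∪ Der ℝ (StrongDual ℝ Y)) := by
  refine Metric.dense_iff.2 fun f r hr => ?_
  rcases f.norm_nonneg'.eq_or_lt with hL | hL
  · refine ⟨f, Metric.mem_ball_self hr, Or.inl ⟨0, 1, zero_ne_one, ?_⟩⟩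
    have h1 := f.norm_sub_le 0 1
    rw [← hL, zero_mul] at h1
    rw [← hL, le_antisymm h1 (norm_nonneg _), zero_div]
  set L := ‖f‖ with hLdef
  obtain ⟨ε, hε, hεr, hεL⟩ : ∃ ε > 0, 10 * ε ≤ r ∧ 4 * ε ≤ L :=
    ⟨min (r / 10) (L / 4), by positivity, by linarith [min_le_left (r / 10) (L / 4)],
      by linarith [min_le_right (r / 10) (L / 4)]⟩
  have : Nonempty {z : ℝ × ℝ // z.1 ≠ z.2} := ⟨⟨(0, 1), zero_ne_one⟩⟩
  obtain ⟨p, q, hpq, hslope⟩ : ∃ p q : ℝ, p < q ∧ (L - ε) * (q - p) < ‖f q - f p‖ := by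
    obtain ⟨⟨⟨p, q⟩, hpq⟩, h⟩ := exists_lt_of_lt_ciSup (show L - ε < _ by
      rw [← f.norm_def]; linarith)
    have hpos : 0 < ‖p - q‖ := norm_pos_iff.2 (sub_ne_zero.2 hpq)
    rw [lt_div_iff₀ hpos] at h
    rcases lt_or_gt_of_ne hpq with h' | h'
    · refine ⟨p, q, h', ?_⟩
      rwa [norm_sub_rev p, norm_sub_rev (f p), Real.norm_of_nonneg (by simp at h'; linarith)] at h
    · refine ⟨q, p, h', ?_⟩
      rwa [Real.norm_of_nonneg (by simp at h'; linarith)] at h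
  obtain ⟨g, hgm, hgi, hg⟩ := f.lipschitzWith.exists_density hZ p q
  have hgd : ∀ᵐ x, x ∈ Set.Ioo p q → HasDerivAt f (g x) x := by
    have hii : IntervalIntegrable g volume p q := (intervalIntegrable_iff_integrableOn_Ioc_of_le
      hpq.le).2 hgi
    filter_upwards [hii.ae_hasDerivAt_integral] with x hx hxm
    have hx' := (hx (by rw [Set.uIcc_of_le hpq.le]; exact Set.Ioo_subset_Icc_self hxm) p
      (by simp)).const_add (f p)
    refine hx'.congr_of_eventuallyEq ?_
    filter_upwards [Ioo_mem_nhds hxm.1 hxm.2] with t ht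
    rw [← hg t (Set.Ioo_subset_Icc_self ht)]; abel
  let B : Set ℝ := {x | x ∈ Set.Ioo p q ∧ L - 2 * ε < ‖g x‖ ∧ ‖g x‖ ≤ L}
  -- Otherwise the slope of `f` over `[p, q]` would be at most `L - 2ε`, against `hslope`.
  have hB : volume B ≠ 0 := fun h0 => by
    have hle : ∀ᵐ x, x ∈ Set.uIoc p q → ‖g x‖ ≤ L - 2 * ε := by
      filter_upwards [hgd, measure_eq_zero_iff_ae_notMem.1 h0, Measure.ae_ne volume q]
        with x hx hxB hxq hxm
      rw [Set.uIoc_of_le hpq.le] at hxm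
      have hx' : x ∈ Set.Ioo p q := ⟨hxm.1, lt_of_le_of_ne hxm.2 hxq⟩
      by_contra! H
      exact hxB ⟨hx', H, f.norm_le_of_hasDerivAt (hx hx')⟩
    have := intervalIntegral.norm_integral_le_of_norm_le_const_ae hle
    rw [← hg q ⟨hpq.le, le_rfl⟩, abs_of_pos (sub_pos.2 hpq)] at this
    nlinarith [sub_pos.2 hpq]
  obtain ⟨c, hc, hgc⟩ := hgm.isSeparable_range
  let A : StrongDual ℝ Y → Set ℝ := fun v => {x | x ∈ B ∧ ‖g x - v‖ < ε}
  obtain ⟨v, -, hA⟩ : ∃ v ∈ c, volume (A v) ≠ 0 := by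
    by_contra! H
    refine hB (measure_mono_null (fun x hx => ?_) ((measure_biUnion_null_iff hc).2 H))
    obtain ⟨v, hv, hxv⟩ := Metric.mem_closure_iff.1 (hgc ⟨x, rfl⟩) ε hε
    exact Set.mem_biUnion hv ⟨hx, by rwa [← dist_eq_norm]⟩
  replace hgd : ∀ᵐ x, x ∈ A v → HasDerivAt f (g x) x := hgd.mono fun x h hx => h hx.1.1
  have hAm : MeasurableSet (A v) := by
    have h1 : MeasurableSet {x | L - 2 * ε < ‖g x‖} :=
      measurableSet_lt measurable_const hgm.norm.measurable
    have h2 : MeasurableSet {x | ‖g x‖ ≤ L} := measurableSet_le hgm.norm.measurable measurable_const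
    have h3 : MeasurableSet {x | ‖g x - v‖ < ε} :=
      measurableSet_lt (hgm.sub stronglyMeasurable_const).norm.measurable measurable_const
    exact (measurableSet_Ioo.inter (h1.inter h2)).inter h3
  have hv : L - 3 * ε ≤ ‖v‖ ∧ ‖v‖ ≤ L + ε := by
    obtain ⟨x, hx⟩ := nonempty_of_measure_ne_zero hA
    have h1 := norm_sub_norm_le (g x) v
    have h2 := norm_sub_norm_le v (g x)
    rw [norm_sub_rev] at h2
    constructor <;> linarith [hx.2, hx.1.2.1, hx.1.2.2]
  have hv0 : 0 < ‖v‖ := by linarith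
  -- The length `L + ε` is at least both `‖f‖` and `‖v‖`: the new derivative then dominates the old
  -- ones, and `w - v` is a nonnegative multiple of `v`.
  let w : StrongDual ℝ Y := ((L + ε) / ‖v‖) • v
  have hw : ‖w‖ = L + ε := by
    rw [norm_smul, norm_div, norm_norm, div_mul_cancel₀ _ hv0.ne', Real.norm_of_nonneg (by linarith)]
  have hwv : ‖w - v‖ ≤ 4 * ε := by
    have : w - v = ((L + ε - ‖v‖) / ‖v‖) • v := by
      ext y
      simp only [w, sub_apply, smul_apply, smul_eq_mul]
      field_simp
    rw [this, norm_smul, norm_div, norm_norm, div_mul_cancel₀ _ hv0.ne',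
      Real.norm_of_nonneg (by linarith)]
    linarith
  let k : ℝ → StrongDual ℝ Y := (A v).indicator fun x => w - g x
  have hk : ∀ x, ‖k x‖ ≤ 5 * ε := fun x => by
    by_cases hx : x ∈ A v
    · simp only [k, Set.indicator_of_mem hx]
      calc ‖w - g x‖ = ‖(w - v) - (g x - v)‖ := by congr 1; abel
        _ ≤ ‖w - v‖ + ‖g x - v‖ := norm_sub_le _ _
        _ ≤ 5 * ε := by linarith [hx.2]
    · simp only [k, Set.indicator_of_notMem hx, norm_zero]; positivity
  have hkm : StronglyMeasurable k := (stronglyMeasurable_const.sub hgm).indicator hAm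
  have hkl : LocallyIntegrable k volume := (MeasureTheory.locallyIntegrable_const (5 * ε)).mono
    hkm.aestronglyMeasurable (.of_forall fun x => (hk x).trans (le_abs_self _))
  have hki : ∀ a b, IntervalIntegrable k volume a b := fun a b =>
    intervalIntegrable_iff.2
      ((hkl.integrableOn_isCompact isCompact_uIcc).mono_set Set.uIoc_subset_uIcc)
  let P : ℝ → StrongDual ℝ Y := fun x => ∫ t in (0 : ℝ)..x, k t
  have hP : ∀ a b, ‖P a - P b‖ ≤ 5 * ε * ‖a - b‖ := fun a b => by
    simp only [P]
    rw [intervalIntegral.integral_interval_sub_left (hki _ _) (hki _ _)]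
    exact intervalIntegral.norm_integral_le_of_norm_le_const fun x _ => hk x
  have hPd : ∀ᵐ x, HasDerivAt P (k x) x :=
    (LocallyIntegrable.ae_hasDerivAt_integral hkl).mono fun x hx => hx 0
  let P' : Lip0 ℝ (StrongDual ℝ Y) := ⟨P, ⟨(5 * ε).toNNReal, LipschitzWith.of_dist_le_mul
    fun a b => by
      rw [dist_eq_norm, dist_eq_norm, Real.coe_toNNReal _ (by positivity)]
      exact hP a b⟩, by simp [P]⟩
  let f₁ : Lip0 ℝ (StrongDual ℝ Y) := f + P'
  have hf₁ : ∀ x, f₁ x = f x + P x := fun x => rfl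
  -- Tested against `y`, the derivative of `f₁` is that of `w` on `A v` and that of `f` elsewhere.
  -- Testing is needed because `f` may have no norm derivative outside `[p, q]`.
  have hf₁n : ‖f₁‖ ≤ L + ε := by
    refine f₁.norm_le_of_forall (by positivity) fun a b => ?_
    refine ContinuousLinearMap.opNorm_le_bound _ (by positivity) fun y => ?_
    have hlip := f₁.lipschitzWith.strongDual_apply y
    have := hlip.norm_sub_le_of_ae_abs_deriv_le (C := (L + ε) * ‖y‖) (by
      filter_upwards [(f.lipschitzWith.strongDual_apply y).ae_differentiableAt_real, hPd, hgd]
        with x hx hPx hgx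
      have hPy : HasDerivAt (fun t => P t y) (k x y) x :=
        hPx.clm_apply (hasDerivAt_const x y) |>.congr_deriv (by simp)
      by_cases hxA : x ∈ A v
      · have hfy : HasDerivAt (fun t => f t y) (g x y) x :=
          (hgx hxA).clm_apply (hasDerivAt_const x y) |>.congr_deriv (by simp)
        have : HasDerivAt (fun t => f₁ t y) (w y) x :=
          (hfy.add hPy).congr_deriv (by simp [k, Set.indicator_of_mem hxA])
        rw [this.deriv, ← hw]
        exact w.le_opNorm y
      · have : HasDerivAt (fun t => f₁ t y) (deriv (fun t => f t y) x) x :=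
          (hx.hasDerivAt.add hPy).congr_deriv (by simp [k, Set.indicator_of_notMem hxA])
        rw [this.deriv]
        have h1 := norm_deriv_le_of_lipschitz (f.lipschitzWith.strongDual_apply y) (x₀ := x)
        rw [NNReal.coe_mul, Real.coe_toNNReal _ f.norm_nonneg', coe_nnnorm, ← hLdef] at h1
        refine h1.trans ?_
        gcongr; linarith) b a
    rw [sub_apply]
    refine this.trans_eq ?_
    rw [Real.norm_eq_abs]; ring
  obtain ⟨x, hxA, hx1, hx2⟩ : ∃ x, x ∈ A v ∧ HasDerivAt f (g x) x ∧ HasDerivAt P (k x) x := by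
    by_contra! H
    refine hA (measure_eq_zero_iff_ae_notMem.2 ?_)
    filter_upwards [hgd, hPd] with x h1 h2 h3
    exact H x h3 (h1 h3) h2
  have hd : HasDerivAt f₁ w x :=
    (hx1.add hx2).congr_deriv (by simp [k, Set.indicator_of_mem hxA])
  refine ⟨f₁, ?_, Or.inr (mem_Der_real_iff.2
    ⟨x, w, hd, le_antisymm (f₁.norm_le_of_hasDerivAt hd) (hw ▸ hf₁n)⟩)⟩
  have : ‖P'‖ ≤ 5 * ε := P'.norm_le_of_forall (by positivity) hP
  rw [Metric.mem_ball, dist_eq_norm, add_sub_cancel_left]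
  linarith

/-! ### Density of the norm-attaining maps implies the RNP. -/

section DenseToRadonNikodym

variable {Y : Type u} [NormedAddCommGroup Y] [NormedSpace ℝ Y]

theorem measurable_weakStar_of_seq {Ω : Type w} [MeasurableSpace Ω] {φ : Ω → StrongDual ℝ Y}
    {b : ℕ → Y} (hb : ∀ y, ‖y‖ ≤ 1 → y ∈ closure (Set.range b))
    (hφ : ∀ n, Measurable fun ω => φ ω (b n)) (y : Y) : Measurable fun ω => φ ω y := by
  have key : ∀ y, ‖y‖ ≤ 1 → Measurable fun ω => φ ω y := fun y hy => by
    obtain ⟨s, hs, hlim⟩ := mem_closure_iff_seq_limit.1 (hb y hy)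
    refine measurable_of_tendsto_metrizable (f := fun n ω => φ ω (s n)) (fun n => ?_)
      (tendsto_pi_nhds.2 fun ω => ((φ ω).continuous.tendsto y).comp hlim)
    obtain ⟨m, hm⟩ := hs n
    simp only [← hm]
    exact hφ m
  rcases eq_or_ne y 0 with rfl | hy
  · simp
  have : (fun ω => φ ω y) = fun ω => ‖y‖ * φ ω (‖y‖⁻¹ • y) := funext fun ω => by
    rw [map_smul, smul_eq_mul, mul_inv_cancel_left₀ (norm_ne_zero_iff.2 hy)]
  rw [this]
  exact (key (‖y‖⁻¹ • y) (by simp [norm_smul, hy])).const_mul ‖y‖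

theorem intervalIntegrable_weakStar {φ : ℝ → StrongDual ℝ Y}
    (hφ : ∀ y, Measurable fun t => φ t y) (hφ1 : ∀ t, ‖φ t‖ ≤ 1) (y : Y) (a b : ℝ) :
    IntervalIntegrable (fun t => φ t y) volume a b :=
  (intervalIntegrable_const (c := ‖y‖)).mono_fun (hφ y).aestronglyMeasurable
    (.of_forall fun t => by
      simp only [norm_norm]
      exact ((φ t).le_opNorm y).trans (mul_le_of_le_one_left (norm_nonneg _) (hφ1 t)))

theorem exists_weakStar_primitive {φ : ℝ → StrongDual ℝ Y}
    (hφ : ∀ y, Measurable fun t => φ t y) (hφ1 : ∀ t, ‖φ t‖ ≤ 1) :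
    ∃ F : ℝ → StrongDual ℝ Y, ∀ x y, F x y = ∫ t in (0 : ℝ)..x, φ t y :=
  ⟨fun x => LinearMap.mkContinuous
    { toFun := fun y => ∫ t in (0 : ℝ)..x, φ t y
      map_add' := fun y z => by
        simp only [map_add]
        exact intervalIntegral.integral_add (intervalIntegrable_weakStar hφ hφ1 y _ _)
          (intervalIntegrable_weakStar hφ hφ1 z _ _)
      map_smul' := fun c y => by
        simp only [map_smul, smul_eq_mul, RingHom.id_apply]
        exact intervalIntegral.integral_const_mul c _ } |x - 0| (fun y => by
      rw [mul_comm]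
      exact intervalIntegral.norm_integral_le_of_norm_le_const fun t _ =>
        ((φ t).le_opNorm y).trans (mul_le_of_le_one_left (norm_nonneg _) (hφ1 t))),
    fun _ _ => rfl⟩

theorem ae_hasDerivAt_weakStar_primitive {φ F : ℝ → StrongDual ℝ Y}
    (hφ : ∀ y, Measurable fun t => φ t y) (hφ1 : ∀ t, ‖φ t‖ ≤ 1)
    (hF : ∀ x y, F x y = ∫ t in (0 : ℝ)..x, φ t y) (y : Y) :
    ∀ᵐ x, HasDerivAt (fun t => F t y) (φ x y) x := by
  have hl : LocallyIntegrable (fun t => φ t y) volume :=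
    (MeasureTheory.locallyIntegrable_const ‖y‖).mono
      (hφ y).aestronglyMeasurable (.of_forall fun t => by
        rw [norm_norm]
        exact ((φ t).le_opNorm y).trans (mul_le_of_le_one_left (norm_nonneg _) (hφ1 t)))
  simp only [hF]
  exact (LocallyIntegrable.ae_hasDerivAt_integral hl).mono fun x hx => hx 0

/-- Applied to `A` and to its complement, this converts increments of the primitives into measures
of `A`. -/
theorem norm_weakStar_primitive_sub_le {φ F : ℝ → StrongDual ℝ Y}
    (hφ : ∀ y, Measurable fun t => φ t y) {S : Set ℝ} (hS : MeasurableSet S)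
    (hφS : ∀ t, ‖φ t‖ ≤ S.indicator 1 t)
    (hF : ∀ x y, F x y = ∫ t in (0 : ℝ)..x, φ t y) (a b : ℝ) :
    ‖F b - F a‖ ≤ volume.real (Set.uIoc a b ∩ S) := by
  have hφ1 : ∀ t, ‖φ t‖ ≤ 1 := fun t =>
    (hφS t).trans (Set.indicator_le_self' (fun _ _ => zero_le_one) t)
  refine ContinuousLinearMap.opNorm_le_bound _ measureReal_nonneg fun y => ?_
  rw [sub_apply, hF, hF, intervalIntegral.integral_interval_sub_left
    (intervalIntegrable_weakStar hφ hφ1 y _ _) (intervalIntegrable_weakStar hφ hφ1 y _ _)]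
  have hfin : volume (Set.uIoc a b) ≠ ∞ := by rw [Real.volume_uIoc]; exact ENNReal.ofReal_ne_top
  calc ‖∫ t in a..b, φ t y‖ ≤ ∫ t in Set.uIoc a b, ‖φ t y‖ :=
        intervalIntegral.norm_integral_le_integral_norm_uIoc
    _ ≤ ∫ t in Set.uIoc a b, S.indicator (fun _ => ‖y‖) t := by
        refine integral_mono (intervalIntegrable_iff.1
          (intervalIntegrable_weakStar hφ hφ1 y a b)).norm
          ((integrableOn_const hfin).indicator hS) fun t => ?_
        refine ((φ t).le_opNorm y).trans ?_
        refine (mul_le_mul_of_nonneg_right (hφS t) (norm_nonneg y)).trans_eq ?_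
        by_cases ht : t ∈ S <;> simp [ht]
    _ = volume.real (Set.uIoc a b ∩ S) * ‖y‖ := by
        rw [setIntegral_indicator hS, setIntegral_const, smul_eq_mul]

theorem SA_real_iff {Z : Type u} [NormedAddCommGroup Z] [NormedSpace ℝ Z] {f : Lip0 ℝ Z} :
    f ∈ SA ℝ Z ↔ ∃ p q : ℝ, p < q ∧ ‖f q - f p‖ = ‖f‖ * (q - p) := by
  constructor
  · rintro ⟨p, q, hpq, h⟩
    have hpos : 0 < ‖p - q‖ := norm_pos_iff.2 (sub_ne_zero.2 hpq)
    rw [eq_div_iff hpos.ne'] at h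
    rcases lt_or_gt_of_ne hpq with h' | h'
    · refine ⟨p, q, h', ?_⟩
      rw [norm_sub_rev, ← h, norm_sub_rev, Real.norm_of_nonneg (sub_pos.2 h').le]
    · refine ⟨q, p, h', ?_⟩
      rw [← h, Real.norm_of_nonneg (sub_pos.2 h').le]
  · rintro ⟨p, q, hpq, h⟩
    refine ⟨q, p, hpq.ne', ?_⟩
    rw [h, Real.norm_of_nonneg (sub_pos.2 hpq).le, mul_div_cancel_right₀ _ (sub_pos.2 hpq).ne']

variable [TopologicalSpace.SeparableSpace Y]

theorem aestronglyMeasurable_of_dense_of_norm_eq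
    (hd : Dense (SA ℝ (StrongDual ℝ Y) ∪ Der ℝ (StrongDual ℝ Y))) {φ : ℝ → StrongDual ℝ Y}
    (hφ : ∀ y, Measurable fun t => φ t y) (hφn : ∀ t, ‖φ t‖ = 0 ∨ ‖φ t‖ = 1) :
    AEStronglyMeasurable φ volume := by
  by_contra hcon
  obtain ⟨b, hb1, -, hb⟩ := exists_seq_norm_le_iff Y
  have hφ1 : ∀ t, ‖φ t‖ ≤ 1 := fun t => by rcases hφn t with h | h <;> simp [h]
  obtain ⟨F, hF⟩ := exists_weakStar_primitive hφ hφ1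
  obtain ⟨s, hs⟩ := exists_surjective_nat (ℚ × ℚ)
  let c : ℕ → StrongDual ℝ Y := fun n =>
    (((s n).2 : ℝ) - (s n).1)⁻¹ • (F (s n).2 - F (s n).1)
  obtain ⟨ε, hε, hεc⟩ : ∃ ε > 0, ¬ ∀ᵐ t, ∃ n, ‖φ t - c n‖ < ε := by
    by_contra! H
    exact hcon (aestronglyMeasurable_of_weakStar hφ fun ε hε => ⟨c, H ε hε⟩)
  -- a compact set of positive measure on which `φ` stays away from the rational slopes of `F`
  let E : Set ℝ := {t | ∃ n, ‖φ t - c n‖ < ε}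
  have hEm : MeasurableSet E := by
    have : E = ⋃ n, {t | ‖φ t - c n‖ < ε} := by ext; simp [E]
    rw [this]
    exact .iUnion fun n => measurableSet_lt
      (measurable_norm_of_weakStar fun y => (hφ y).sub_const _) measurable_const
  have hgood : ∀ᵐ x, (∀ n, HasDerivAt (fun t => F t (b n)) (φ x (b n)) x) ∧ Irrational x := by
    refine (ae_all_iff.2 fun n => ae_hasDerivAt_weakStar_primitive hφ hφ1 hF (b n)).and ?_
    have := (Set.countable_range ((↑) : ℚ → ℝ)).measure_zero volume
    exact measure_eq_zero_iff_ae_notMem.1 this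
  obtain ⟨T, hTsub, hTm, hT0⟩ := exists_measurable_superset_of_null (ae_iff.1 hgood)
  obtain ⟨A, hAsub, hAc, hA0⟩ : ∃ A ⊆ Eᶜ \ T, IsCompact A ∧ 0 < volume A := by
    refine (hEm.compl.diff hTm).exists_lt_isCompact ?_
    rw [measure_sdiff_null hT0, pos_iff_ne_zero]
    exact fun h => hεc (ae_iff.2 h)
  have hAE : ∀ t ∈ A, ∀ n, ε ≤ ‖φ t - c n‖ := fun t ht n => by
    by_contra! H
    exact (hAsub ht).1 ⟨n, H⟩
  have hAg : ∀ x ∈ A, (∀ n, HasDerivAt (fun t => F t (b n)) (φ x (b n)) x) ∧ Irrational x :=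
    fun x hx => by
      by_contra H
      exact (hAsub hx).2 (hTsub H)
  have hAm : MeasurableSet A := hAc.measurableSet
  -- The pair `(0, 0)` has slope 0 by the convention `0⁻¹ = 0`, so staying away from the slopes
  -- excludes `φ t = 0`.
  have hA1 : ∀ t ∈ A, ‖φ t‖ = 1 := fun t ht => by
    obtain ⟨n, hn⟩ := hs (0, 0)
    have := hAE t ht n
    simp only [c, hn, sub_self, inv_zero, zero_smul, sub_zero] at this
    exact (hφn t).resolve_left (by linarith)
  -- the primitive of `φ` restricted to this set
  let ψ : ℝ → StrongDual ℝ Y := A.indicator φ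
  have hψ : ∀ y, Measurable fun t => ψ t y := fun y => by
    have : (fun t => ψ t y) = A.indicator fun t => φ t y := by
      ext t; by_cases ht : t ∈ A <;> simp [ψ, ht]
    rw [this]
    exact (hφ y).indicator hAm
  have hψA : ∀ t, ‖ψ t‖ ≤ A.indicator 1 t := fun t => by
    by_cases ht : t ∈ A <;> simp [ψ, ht, hφ1]
  have hψ1 : ∀ t, ‖ψ t‖ ≤ 1 := fun t =>
    (hψA t).trans (Set.indicator_le_self' (fun _ _ => zero_le_one) t)
  obtain ⟨f, hf⟩ := exists_weakStar_primitive hψ hψ1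
  have hfA : ∀ a b, ‖f b - f a‖ ≤ volume.real (Set.uIoc a b ∩ A) :=
    norm_weakStar_primitive_sub_le hψ hAm hψA hf
  have hfin : ∀ a b : ℝ, volume (Set.uIoc a b) ≠ ∞ := fun a b => by
    rw [Real.volume_uIoc]; exact ENNReal.ofReal_ne_top
  have hvol : ∀ a b : ℝ, volume.real (Set.uIoc a b) = |b - a| := fun a b => by
    rw [Measure.real, Real.volume_uIoc, ENNReal.toReal_ofReal (abs_nonneg _)]
  have hFf : ∀ a b, ‖(F b - F a) - (f b - f a)‖ ≤ |b - a| - volume.real (Set.uIoc a b ∩ A) := by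
    intro a b
    have h1 := norm_weakStar_primitive_sub_le (φ := fun t => φ t - ψ t) (F := fun t => F t - f t)
      (fun y => (hφ y).sub (hψ y)) hAm.compl
      (fun t => by by_cases ht : t ∈ A <;> simp [ψ, ht, hφ1])
      (fun x y => by
        simp only [sub_apply, hF, hf]
        exact (intervalIntegral.integral_sub (intervalIntegrable_weakStar hφ hφ1 y _ _)
          (intervalIntegrable_weakStar hψ hψ1 y _ _)).symm) a b
    have h2 := measureReal_inter_add_sdiff (μ := volume) (s := Set.uIoc a b) hAm (hfin a b)
    rw [hvol, Set.sdiff_eq] at h2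
    have h3 : (F b - F a) - (f b - f a) = (F b - f b) - (F a - f a) := by abel
    rw [h3]
    linarith
  have hf1 : ∀ a b, ‖f b - f a‖ ≤ |b - a| := fun a b =>
    (hfA a b).trans ((measureReal_mono Set.inter_subset_left (hfin a b)).trans_eq (hvol a b))
  have hflat : ∀ a b, Disjoint (Set.uIcc a b) A → f b = f a := fun a b h => by
    have h1 := hfA a b
    rw [(h.mono_left Set.uIoc_subset_uIcc).inter_eq, measureReal_empty] at h1
    exact sub_eq_zero.1 (norm_le_zero_iff.1 h1)
  let f₀ : Lip0 ℝ (StrongDual ℝ Y) := ⟨f, ⟨1, LipschitzWith.of_dist_le_mul fun a b => by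
    rw [dist_eq_norm, dist_eq_norm, NNReal.coe_one, one_mul]
    exact hf1 b a⟩, by ext y; simp [hf]⟩
  -- At almost every point of `A`, the derivative of `f` tested against the `b n` is that of `φ`,
  -- which has norm 1.
  have hf₀ : 1 ≤ ‖f₀‖ := by
    obtain ⟨x, hxA, hx⟩ : ∃ x ∈ A, ∀ n, HasDerivAt (fun t => f t (b n)) (ψ x (b n)) x := by
      by_contra! H
      refine hA0.ne' (measure_eq_zero_iff_ae_notMem.2 ?_)
      filter_upwards [ae_all_iff.2 fun n => ae_hasDerivAt_weakStar_primitive hψ hψ1 hf (b n)]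
        with x hx hxA
      obtain ⟨n, hn⟩ := H x hxA
      exact hn (hx n)
    rw [← hA1 x hxA, hb]
    refine ⟨f₀.norm_nonneg', fun n => ?_⟩
    have h1 := norm_deriv_le_of_lipschitz (f₀.lipschitzWith.strongDual_apply (b n)) (x₀ := x)
    rw [NNReal.coe_mul, Real.coe_toNNReal _ f₀.norm_nonneg', coe_nnnorm, (hx n).deriv] at h1
    simp only [ψ, Set.indicator_of_mem hxA] at h1
    exact h1.trans (mul_le_of_le_one_right f₀.norm_nonneg' (hb1 n))
  obtain ⟨δ, hδ, hδε, hδ1⟩ : ∃ δ > 0, 20 * δ ≤ ε ∧ 20 * δ ≤ 1 :=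
    ⟨min (ε / 20) (1 / 20), by positivity, by linarith [min_le_left (ε / 20) (1 / 20)],
      by linarith [min_le_right (ε / 20) (1 / 20)]⟩
  obtain ⟨g, hgball, hg⟩ := Metric.dense_iff.1 hd f₀ δ hδ
  rw [Metric.mem_ball, dist_eq_norm] at hgball
  have hgf : ∀ a b, ‖(g a - g b) - (f a - f b)‖ ≤ δ * |a - b| := fun a b => by
    have h1 := (g - f₀).norm_sub_le a b
    have h2 : (g a - g b) - (f a - f b) = (g - f₀) a - (g - f₀) b := by
      change _ = (g a - f a) - (g b - f b)
      abel
    rw [h2]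
    exact h1.trans (mul_le_mul_of_nonneg_right hgball.le (abs_nonneg _))
  have hgn : 1 - δ < ‖g‖ := by
    have := norm_sub_norm_le f₀ g
    rw [norm_sub_rev] at this
    linarith
  rcases hg with hg | hg
  · obtain ⟨p, q, hpq, h⟩ := SA_real_iff.1 hg
    -- Attainment on `p, q` would force slope `‖g‖` on every subinterval, but near a rational `f` is
    -- constant, so `g` has slope at most `δ` there.
    obtain ⟨r, hpr, hrq⟩ := exists_rat_btwn hpq
    have hrA : (r : ℝ) ∉ A := fun hr => (hAg r hr).2 ⟨r, rfl⟩
    obtain ⟨η, hη, hηA⟩ := Metric.isOpen_iff.1 (hAc.isClosed.isOpen_compl.inter isOpen_Ioo) (r : ℝ)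
      (show (r : ℝ) ∈ Aᶜ ∩ Set.Ioo p q from ⟨hrA, hpr, hrq⟩)
    have hmem : ∀ t ∈ Set.Icc (r : ℝ) (r + η / 2), t ∈ Aᶜ ∩ Set.Ioo p q := fun t ht => by
      refine hηA ?_
      rw [Metric.mem_ball, Real.dist_eq, abs_of_nonneg (by linarith [ht.1])]
      linarith [ht.2]
    have hfl := hflat r (r + η / 2) (by
      rw [Set.uIcc_of_le (by linarith)]
      exact Set.disjoint_left.2 fun t ht => (hmem t ht).1)
    have hq := (hmem (r + η / 2) ⟨by linarith, le_rfl⟩).2.2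
    have h1 := hgf (r + η / 2) r
    rw [hfl, sub_self, sub_zero, add_sub_cancel_left, abs_of_pos (by positivity)] at h1
    have h2 := g.norm_sub_le q (r + η / 2)
    have h3 := g.norm_sub_le r p
    rw [Real.norm_of_nonneg (by linarith)] at h2 h3
    have h4 : ‖g q - g p‖ ≤ ‖g q - g (r + η / 2)‖ + ‖g (r + η / 2) - g r‖ + ‖g r - g p‖ := by
      have : g q - g p = (g q - g (r + η / 2)) + (g (r + η / 2) - g r) + (g r - g p) := by abel
      rw [this]
      exact norm_add₃_le
    have h5 : 0 < (‖g‖ - δ) * (η / 2) := mul_pos (by linarith) (by positivity)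
    nlinarith
  · obtain ⟨x, z, hz, hzn⟩ := mem_Der_real_iff.1 hg
    obtain ⟨ρ, hρ, hgz⟩ : ∃ ρ > 0, ∀ t, |t - x| < ρ → ‖g t - g x - (t - x) • z‖ ≤ δ * |t - x| := by
      have := (hasDerivAt_iff_isLittleO.1 hz).def hδ
      obtain ⟨ρ, hρ, h⟩ := Metric.eventually_nhds_iff.1 this
      exact ⟨ρ, hρ, fun t ht => h (by rwa [Real.dist_eq])⟩
    have hfz : ∀ t, |t - x| < ρ → ‖f t - f x - (t - x) • z‖ ≤ 2 * δ * |t - x| := fun t ht => by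
      have : f t - f x - (t - x) • z =
          (g t - g x - (t - x) • z) - ((g t - g x) - (f t - f x)) := by abel
      rw [this]
      refine (norm_sub_le _ _).trans ?_
      linarith [hgz t ht, hgf t x]
    -- `1 - 3δ` arises from `‖z‖ = ‖g‖ > 1 - δ` and the error `2δ` in `hfz`.
    have hfl : ∀ t, |t - x| < ρ → (1 - 3 * δ) * |t - x| ≤ ‖f t - f x‖ := fun t ht => by
      have h1 := norm_sub_norm_le ((t - x) • z) (f t - f x)
      rw [norm_sub_rev ((t - x) • z), norm_smul, hzn, Real.norm_eq_abs] at h1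
      nlinarith [hfz t ht, abs_nonneg (t - x)]
    have hxA : x ∈ A := by
      by_contra hxA
      obtain ⟨η, hη, hηA⟩ := Metric.isOpen_iff.1 hAc.isClosed.isOpen_compl x hxA
      have hm : 0 < min η ρ := lt_min hη hρ
      have habs : |x + min η ρ / 2 - x| = min η ρ / 2 := by
        rw [add_sub_cancel_left, abs_of_pos (by positivity)]
      have h1 := hfl (x + min η ρ / 2) (by rw [habs]; linarith [min_le_right η ρ])
      rw [hflat x (x + min η ρ / 2) (by
        rw [Set.uIcc_of_le (by linarith)]
        refine Set.disjoint_left.2 fun t ht => hηA ?_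
        rw [Metric.mem_ball, Real.dist_eq, abs_of_nonneg (by linarith [ht.1])]
        linarith [ht.2, min_le_left η ρ]), sub_self, norm_zero, habs] at h1
      nlinarith
    -- By `hfl` and `hfA`, `A` fills at least the fraction `1 - 3δ` of the interval between `x` and
    -- `t`, so `F - f` moves by at most `3δ|t - x|`; `hfz` adds `2δ`.
    have hFz : ∀ t, |t - x| < ρ → ‖F t - F x - (t - x) • z‖ ≤ 5 * δ * |t - x| := fun t ht => by
      have : F t - F x - (t - x) • z =
          ((F t - F x) - (f t - f x)) + (f t - f x - (t - x) • z) := by abel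
      rw [this]
      refine (norm_add_le _ _).trans ?_
      linarith [hfz t ht, hFf x t, hfA x t, hfl t ht]
    have hφz : ‖φ x - z‖ ≤ 5 * δ := by
      rw [hb]
      refine ⟨by positivity, fun n => ?_⟩
      have hder : HasDerivAt (fun t => F t (b n) - t * z (b n)) ((φ x - z) (b n)) x :=
        (((hAg x hxA).1 n).sub ((hasDerivAt_id x).mul_const (z (b n)))).congr_deriv (by simp)
      refine hder.le_of_lip' (by positivity) ?_
      filter_upwards [Metric.ball_mem_nhds x hρ] with t ht
      rw [Metric.mem_ball, Real.dist_eq] at ht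
      have h1 := (F t - F x - (t - x) • z).le_opNorm (b n)
      have h2 : (F t - F x - (t - x) • z) (b n) =
          F t (b n) - t * z (b n) - (F x (b n) - x * z (b n)) := by
        simp only [sub_apply, smul_apply, smul_eq_mul]; ring
      rw [h2] at h1
      exact h1.trans ((mul_le_of_le_one_right (norm_nonneg _) (hb1 n)).trans (hFz t ht))
    -- A rational slope straddling `x` averages two estimates from `hFz`, hence is within `5δ` of
    -- `z`. So `φ x` is within `10δ < ε` of some `c n`, against `hAE`.
    obtain ⟨p, hp1, hp2⟩ := exists_rat_btwn (show x - ρ < x by linarith)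
    obtain ⟨q, hq1, hq2⟩ := exists_rat_btwn (show x < x + ρ by linarith)
    obtain ⟨n, hn⟩ := hs (p, q)
    have hpq : (0 : ℝ) < q - p := by linarith
    have hcz : ‖c n - z‖ ≤ 5 * δ := by
      have h1 := hFz q (by rw [abs_of_pos (by linarith)]; linarith)
      have h2 := hFz p (by rw [abs_of_neg (by linarith)]; linarith)
      rw [abs_of_pos (by linarith)] at h1
      rw [abs_of_neg (by linarith)] at h2
      have h3 : c n - z = ((q : ℝ) - p)⁻¹ •
          ((F q - F x - ((q : ℝ) - x) • z) - (F p - F x - ((p : ℝ) - x) • z)) := by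
        ext y
        simp only [c, hn, sub_apply, smul_apply, smul_eq_mul]
        field_simp
        ring
      rw [h3, norm_smul, norm_inv, Real.norm_of_nonneg hpq.le, inv_mul_le_iff₀ hpq]
      refine (norm_sub_le _ _).trans ?_
      linarith
    have h1 := hAE x hxA n
    have h2 : ‖φ x - c n‖ ≤ ‖φ x - z‖ + ‖c n - z‖ := by
      rw [norm_sub_rev (c n)]
      exact norm_sub_le_norm_sub_add_norm_sub _ _ _
    linarith

theorem aestronglyMeasurable_of_dense
    (hd : Dense (SA ℝ (StrongDual ℝ Y) ∪ Der ℝ (StrongDual ℝ Y))) {φ : ℝ → StrongDual ℝ Y}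
    (hφ : ∀ y, Measurable fun t => φ t y) : AEStronglyMeasurable φ volume := by
  have hn := measurable_norm_of_weakStar hφ
  have h := aestronglyMeasurable_of_dense_of_norm_eq hd (φ := fun t => ‖φ t‖⁻¹ • φ t)
    (fun y => hn.inv.mul (hφ y)) (fun t => by
      rcases eq_or_ne (φ t) 0 with h | h
      · simp [h]
      · simp [norm_smul, h])
  refine (hn.aestronglyMeasurable.smul h).congr (.of_forall fun t => ?_)
  rcases eq_or_ne (φ t) 0 with h | h
  · simp [h]
  · simp [smul_smul, h]

/-! ### Transport from the real line to arbitrary finite measure spaces. -/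

theorem hasRadonNikodymProperty_of_dense
    (hd : Dense (SA ℝ (StrongDual ℝ Y) ∪ Der ℝ (StrongDual ℝ Y))) :
    HasRadonNikodymProperty.{u, w} (StrongDual ℝ Y) := by
  classical
  refine hasRadonNikodymProperty_of_aestronglyMeasurable fun Ω _ ν _ h hm h1 => ?_
  rcases eq_or_ne ν 0 with rfl | hν
  · exact aestronglyMeasurable_zero_measure h
  obtain ⟨b, hb1, hbd, hb⟩ := exists_seq_norm_le_iff Y
  have : NeZero ν := ⟨hν⟩
  let ν' : Measure Ω := (ν Set.univ)⁻¹ • ν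
  -- Coordinates along `b` embed the dual in a Polish space. The unit ball has compact image by
  -- Banach–Alaoglu, so the inverse `j`, set to 0 off `K`, is weak-star measurable.
  let e : StrongDual ℝ Y → ℕ → ℝ := fun φ n => φ (b n)
  have he : Function.Injective e := fun φ φ' hφ => by
    refine sub_eq_zero.1 (norm_le_zero_iff.1 ((hb _ _).2 ⟨le_rfl, fun n => ?_⟩))
    have : φ (b n) = φ' (b n) := congrFun hφ n
    simp [this]
  let K : Set (ℕ → ℝ) := e '' Metric.closedBall 0 1
  have hK : IsClosed K := by
    have : K = (fun (φ : WeakDual ℝ Y) n => φ (b n)) ''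
        (WeakDual.toStrongDual ⁻¹' Metric.closedBall (0 : StrongDual ℝ Y) 1) := rfl
    rw [this]
    exact ((WeakDual.isCompact_closedBall (0 : StrongDual ℝ Y) 1).image
      (continuous_pi fun n => WeakDual.eval_continuous (b n))).isClosed
  have hj : ∀ z : ℕ → ℝ, ∃ φ : StrongDual ℝ Y, (z ∈ K → e φ = z) ∧ (z ∉ K → φ = 0) := fun z => by
    by_cases hz : z ∈ K
    · obtain ⟨φ, -, hφ⟩ := id hz
      exact ⟨φ, fun _ => hφ, fun h => absurd hz h⟩
    · exact ⟨0, fun h => absurd h hz, fun _ => rfl⟩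
  choose j hjK hj0 using hj
  have hjm : ∀ y, Measurable fun z => j z y := measurable_weakStar_of_seq hbd fun n => by
    have : (fun z => j z (b n)) = K.indicator fun z => z n := by
      ext z
      by_cases hz : z ∈ K
      · rw [Set.indicator_of_mem hz]; exact congrFun (hjK z hz) n
      · rw [Set.indicator_of_notMem hz, hj0 z hz]; rfl
    rw [this]
    exact (measurable_pi_apply n).indicator hK.measurableSet
  let Φ : Ω → ℕ → ℝ := fun ω => e (h ω)
  have hΦ : Measurable Φ := measurable_pi_lambda _ fun n => hm (b n)
  have hjΦ : ∀ ω, j (Φ ω) = h ω := fun ω =>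
    he (hjK _ ⟨h ω, mem_closedBall_zero_iff.2 (h1 ω), rfl⟩)
  have : IsProbabilityMeasure (ν'.map Φ) := Measure.isProbabilityMeasure_map hΦ.aemeasurable
  -- The law of `h` in coordinates is the image of Lebesgue measure on `[0, 1]`. Having essentially
  -- separable range depends only on this law, so it passes from `j ∘ ψ` to `h`.
  obtain ⟨ψ, hψ, hψmap⟩ := (ν'.map Φ).exists_measurable_map_eq
  have hproj : Measurable (Set.projIcc (0 : ℝ) 1 zero_le_one) := continuous_projIcc.measurable
  have hsm := aestronglyMeasurable_of_dense hd
    (φ := fun t => j (ψ (Set.projIcc 0 1 zero_le_one t)))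
    (fun y => (hjm y).comp (hψ.comp hproj))
  obtain ⟨t, ⟨c, hc, htc⟩, ht⟩ := hsm.isSeparable_ae_range
  refine aestronglyMeasurable_of_weakStar hm fun ε hε => ?_
  obtain ⟨s, hs⟩ := (hc.insert 0).exists_eq_range (Set.insert_nonempty _ _)
  refine ⟨s, ?_⟩
  have hSm : MeasurableSet {z | ∃ n, ‖j z - s n‖ < ε} := by
    have : {z | ∃ n, ‖j z - s n‖ < ε} = ⋃ n, {z | ‖j z - s n‖ < ε} := by ext; simp
    rw [this]
    exact .iUnion fun n => measurableSet_lt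
      (measurable_norm_of_weakStar fun y => (hjm y).sub_const _) measurable_const
  have hI : ∀ᵐ i, ∃ n, ‖j (ψ i) - s n‖ < ε := by
    have h2 := unitInterval.measurePreserving_coe.quasiMeasurePreserving.ae (ae_restrict_of_ae ht)
    filter_upwards [h2] with i hi
    rw [Set.projIcc_val] at hi
    obtain ⟨v, hv, hvi⟩ := Metric.mem_closure_iff.1 (htc hi) ε hε
    obtain ⟨n, rfl⟩ := hs.subset (Set.mem_insert_of_mem 0 hv)
    exact ⟨n, by rwa [← dist_eq_norm]⟩
  have hP : ∀ᵐ z ∂(ν'.map Φ), ∃ n, ‖j z - s n‖ < ε := by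
    rw [← hψmap]
    exact (ae_map_iff hψ.aemeasurable hSm).2 hI
  have hν' := (ae_map_iff hΦ.aemeasurable hSm).1 hP
  simp only [hjΦ] at hν'
  exact (Measure.absolutelyContinuous_smul
    (ENNReal.inv_ne_zero.2 (measure_ne_top ν Set.univ))).ae_le hν'

end DenseToRadonNikodym

theorem mainTheorem11 (Y : Type u) [NormedAddCommGroup Y] [NormedSpace ℝ Y] [CompleteSpace Y]
    [TopologicalSpace.SeparableSpace Y] :
    HasRadonNikodymProperty.{u, w} (StrongDual ℝ Y) ↔
      Dense (SA ℝ (StrongDual ℝ Y) ∪ Der ℝ (StrongDual ℝ Y)) :=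
  ⟨dense_SA_union_Der_of_hasRadonNikodymProperty, hasRadonNikodymProperty_of_dense⟩
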